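/- Let $R$ be a commutative ring. For a simplicial set $X$, let $\Delta(X)$ be its category of simplices: its objects are the pairs $([n],\sigma)$ with $\sigma\in X_n$, and a morphism $([m],\tau)\to([n],\sigma)$ is a morphism $f:[m]\to[n]$ of the simplex category with $f^*\sigma=\tau$. A coefficient system for $X$ is a functor $\mathcal M:\Delta(X)\to R\text{-Mod}$; its cohomology $H^*(X;\mathcal M)$ is the cohomology of the cochain complex $C^n(X;\mathcal M)=\prod_{\sigma\in X_n}\mathcal M(\sigma)$ with $(\delta f)(\sigma)=\sum_{i=0}^{n+1}(-1)^i d^i_*\bigl(f(d_i\sigma)\bigr)$ for $f\in C^n(X;\mathcal M)$, $\sigma\in X_{n+1}$. A simplicial map $\lambda:X\to Y$ and a coefficient system $\mathcal M$ for $Y$ give the coefficient system $\lambda^*\mathcal M=\mathcal M\circ\Delta(\lambda)$ for $X$, and $\lambda^*:H^*(Y;\mathcal M)\to H^*(X;\lambda^*\mathcal M)$ is induced by the cochain map $(\lambda^* f)(\sigma)=f(\lambda(\sigma))$. For a small category $\mathcal C$ with nerve $N\mathcal C$, the Thomason cohomology with coefficients in $\mathcal M:\Delta(N\mathcal C)\to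 R\text{-Mod}$ is $H^*_{Th}(\mathcal C;\mathcal M):=H^*(N\mathcal C;\mathcal M)$. For a small category $\mathcal D$ and a functor $F:\mathcal D\to sSet$, $\operatorname{hocolim}_{\mathcal D}F$ is the diagonal of the bisimplicial set $N(\mathcal D;F)$ with $N(\mathcal D;F)_{p,q}=\coprod_{d_0\to\cdots\to d_p}F(d_0)_q$, the coproduct being over $N\mathcal D_p$, and $(f_h,f_v)^*(\sigma,x)=\bigl(f_h^*\sigma,\;F(d_0\to d_{f_h(0)})(f_v^*x)\bigr)$ for $\sigma=(d_0\to\cdots\to d_p)$, where $d_0\to d_{f_h(0)}$ is the composite in $\sigma$. **Theorem.** Let $\varphi:\mathcal C\to\mathcal D$ be a functor between two small categories. For $d\in\mathcal D$ let $\varphi/d$ be the comma category of pairs $(c,\ \mu:\varphi(c)\to d)$, and let $X=\operatorname{hocolim}_{\mathcal D}N(\varphi/ -)$. Let $\kappa:X\to N\mathcal C$ be the simplicial map induced by the projections $\varphi/d\to\mathcal C$, $(c,\mu)\mapsto c$; that is, identifying an $n$-simplex of $X$ with a triple $(\sigma,\tau,\mu)$, where $\sigma=(d_0\to\cdots\to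 d_n)\in N\mathcal D_n$, $\tau=(c_0\to\cdots\to c_n)\in N\mathcal C_n$ and $\mu:\varphi(c_n)\to d_0$, one has $\kappa(\sigma,\tau,\mu)=\tau$. Then for every coefficient system $\mathcal M:\Delta(N\mathcal C)\to R\text{-Mod}$ and every $n\ge 0$, the homomorphism $$\kappa^*:H^n_{Th}(\mathcal C;\mathcal M)\longrightarrow H^n(X;\kappa^*\mathcal M)$$ induced by $\kappa$ is an isomorphism of $R$-modules. -/

import Mathlib

open CategoryTheory Opposite
open scoped Simplicial

universe w r v u

/-! ### Cohomology of a simplicial set with coefficients -/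

/-- The category of simplices `Δ(X)` of a simplicial set `X`: objects are pairs `([n], σ)` with
`σ ∈ Xₙ`, and morphisms `([m], τ) ⟶ ([n], σ)` are the maps `f : [m] ⟶ [n]` of the simplex category
such that `f^* σ = τ`.  (Mathlib's category of elements of the contravariant functor `X` has the
opposite direction of arrows.) -/
abbrev SimplexCat (X : SSet.{u}) : Type u := (Functor.Elements X)ᵒᵖ

namespace SimplexCat

/-- The object `([n], σ)` of `Δ(X)`. -/
abbrev mk {X : SSet.{u}} {n : SimplexCategory} (σ : X.obj (op n)) : SimplexCat X :=
  op ⟨op n, σ⟩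

/-- A map `f : [m] ⟶ [n]` and a simplex `σ ∈ Xₙ` give a morphism `([m], f^* σ) ⟶ ([n], σ)`. -/
abbrev homOf {X : SSet.{u}} {m n : SimplexCategory} (f : m ⟶ n) (σ : X.obj (op n)) :
    mk (X.map f.op σ) ⟶ mk σ :=
  Quiver.Hom.op (CategoryOfElements.homMk (F := X) ⟨op n, σ⟩ ⟨op m, X.map f.op σ⟩ f.op rfl)

/-- The functor `Δ(X) ⥤ Δ(Y)` induced by a simplicial map `X ⟶ Y`. -/
abbrev map {X Y : SSet.{u}} (g : X ⟶ Y) : SimplexCat X ⥤ SimplexCat Y :=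
  (CategoryOfElements.map g).op

end SimplexCat

/-- A coefficient system over `R` for `X`: a covariant functor from `Δ(X)` to `R`-modules. -/
abbrev CoeffSystem (R : Type r) [CommRing R] (X : SSet.{u}) :=
  SimplexCat X ⥤ ModuleCat.{w} R

namespace CoeffSystem

variable {R : Type r} [CommRing R]

/-- The pulled back coefficient system `g^* M`, with `(g^* M)(σ) = M(g σ)`. -/
abbrev pullback {X Y : SSet.{u}} (g : X ⟶ Y) (M : CoeffSystem.{w} R Y) : CoeffSystem.{w} R X :=
  SimplexCat.map g ⋙ M

variable {X Y : SSet.{u}} (M : CoeffSystem.{w} R X)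

/-- `Cⁿ(X; M)`, the module of all families `c` with `c σ ∈ M(σ)` for `σ ∈ Xₙ`. -/
abbrev Cochain (n : SimplexCategory) : Type max u w :=
  (σ : X.obj (op n)) → M.obj (SimplexCat.mk σ)

/-- Functoriality of cochains: `(f_* c)(σ) = M(f)(c(f^* σ))` for `f : [m] ⟶ [n]`, `σ ∈ Xₙ`. -/
def Cochain.map {m n : SimplexCategory} (f : m ⟶ n) : M.Cochain m →ₗ[R] M.Cochain n where
  toFun c σ := M.map (SimplexCat.homOf f σ) (c (X.map f.op σ))
  map_add' c c' := by ext σ; simp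
  map_smul' a c := by ext σ; simp

lemma map_section_congr {m n : SimplexCategory} (c : M.Cochain m) {σ : X.obj (op n)}
    {τ τ' : X.obj (op m)} (h : τ = τ') (a : SimplexCat.mk τ ⟶ SimplexCat.mk σ)
    (b : SimplexCat.mk τ' ⟶ SimplexCat.mk σ) (hab : a.unop.val = b.unop.val) :
    M.map a (c τ) = M.map b (c τ') := by
  subst h
  have : a = b := Quiver.Hom.unop_inj (CategoryOfElements.ext _ _ _ hab)
  rw [this]

/-- The cosimplicial module `[n] ↦ Cⁿ(X; M)`. -/
def cosimplicial : CosimplicialObject (ModuleCat.{max u w} R) where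
  obj n := ModuleCat.of R (M.Cochain n)
  map f := ModuleCat.ofHom (Cochain.map M f)
  map_id n := by
    ext c σ
    change M.map (SimplexCat.homOf (𝟙 n) σ) (c (X.map (𝟙 n).op σ)) = c σ
    have h : X.map (𝟙 n).op σ = σ := by simp
    refine (map_section_congr M c h (SimplexCat.homOf (𝟙 n) σ) (𝟙 (SimplexCat.mk σ)) rfl).trans ?_
    simp
  map_comp {a b d} f g := by
    ext c σ
    change M.map (SimplexCat.homOf (f ≫ g) σ) (c (X.map (f ≫ g).op σ)) =
      M.map (SimplexCat.homOf g σ) (M.map (SimplexCat.homOf f (X.map g.op σ))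
        (c (X.map f.op (X.map g.op σ))))
    rw [← ModuleCat.comp_apply, ← M.map_comp]
    exact map_section_congr M c (by simp) _ _ rfl

/-- The cochain complex `C^*(X; M)`, whose differential is the alternating sum of the cofaces,
`(δ c)(σ) = ∑ᵢ (-1)ⁱ M(dⁱ)(c(dᵢ σ))`. -/
noncomputable def cochainComplex : CochainComplex (ModuleCat.{max u w} R) ℕ :=
  (AlgebraicTopology.alternatingCofaceMapComplex _).obj M.cosimplicial

/-- The differential of `C^*(X; M)` in formulas. -/
lemma cochainComplex_d_apply (n : ℕ) (c : M.Cochain ⦋n⦌) (σ : X.obj (op ⦋n + 1⦌)) :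
    (M.cochainComplex.d n (n + 1) c : M.Cochain ⦋n + 1⦌) σ =
      ∑ i : Fin (n + 2), (-1 : ℤ) ^ (i : ℕ) •
        M.map (SimplexCat.homOf (SimplexCategory.δ i) σ) (c (X.δ i σ)) := by
  have h : M.cochainComplex.d n (n + 1) =
      AlgebraicTopology.AlternatingCofaceMapComplex.objD M.cosimplicial n :=
    CochainComplex.of_d (fun n => M.cosimplicial.obj ⦋n⦌)
      (AlgebraicTopology.AlternatingCofaceMapComplex.objD M.cosimplicial) n
  rw [h]
  have h' : ∀ (ι : Type) (t : Finset ι) (a : ι → ℤ)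
      (f : ι → (ModuleCat.of R (M.Cochain ⦋n⦌) ⟶ ModuleCat.of R (M.Cochain ⦋n + 1⦌))),
      ((∑ i ∈ t, a i • f i).hom c : M.Cochain ⦋n + 1⦌) σ =
        ∑ i ∈ t, a i • ((f i).hom c : M.Cochain ⦋n + 1⦌) σ := by
    intro ι t a f
    simp [ModuleCat.hom_sum, LinearMap.sum_apply, Finset.sum_apply]
  exact h' _ Finset.univ _ fun i => ModuleCat.ofHom (Cochain.map M (SimplexCategory.δ i))

/-- The cohomology `Hⁿ(X; M)` of the simplicial set `X` with coefficients in `M`. -/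
noncomputable def cohomology (n : ℕ) : ModuleCat.{max u w} R :=
  M.cochainComplex.homology n

/-- The map `g^* : C^*(Y; M) ⟶ C^*(X; g^* M)`, `(g^* c)(σ) = c(g σ)`, of cosimplicial modules. -/
def cosimplicialMap (g : X ⟶ Y) (M : CoeffSystem.{w} R Y) :
    M.cosimplicial ⟶ (pullback g M).cosimplicial where
  app n := ModuleCat.ofHom
    { toFun := fun (c : M.Cochain n) σ => c (g.app (op n) σ)
      map_add' := fun _ _ => rfl
      map_smul' := fun _ _ => rfl }
  naturality {m n} f := by
    ext c
    funext (σ : X.obj (op n))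
    change M.map (SimplexCat.homOf f (g.app _ σ)) (c (Y.map f.op (g.app _ σ))) =
      M.map ((SimplexCat.map g).map (SimplexCat.homOf f σ)) (c (g.app _ (X.map f.op σ)))
    exact map_section_congr M c (by simp) _ _ rfl

/-- The cochain map `g^* : C^*(Y; M) ⟶ C^*(X; g^* M)`, `(g^* c)(σ) = c(g σ)`. -/
noncomputable def cochainMap (g : X ⟶ Y) (M : CoeffSystem.{w} R Y) :
    M.cochainComplex ⟶ (pullback g M).cochainComplex :=
  (AlgebraicTopology.alternatingCofaceMapComplex _).map (cosimplicialMap g M)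

/-- The map `g^* : Hⁿ(Y; M) ⟶ Hⁿ(X; g^* M)` induced by a simplicial map `g : X ⟶ Y`. -/
noncomputable def cohomologyMap (g : X ⟶ Y) (M : CoeffSystem.{w} R Y) (n : ℕ) :
    M.cohomology n ⟶ (pullback g M).cohomology n :=
  HomologicalComplex.homologyMap (cochainMap g M) n

end CoeffSystem

/-- Thomason cohomology of a small category `C` with coefficients in a coefficient system for
its nerve. -/
noncomputable abbrev thomasonCohomology {R : Type r} [CommRing R] (C : Type u) [Category.{v} C]
    (M : CoeffSystem.{w} R (nerve C)) (n : ℕ) : ModuleCat R :=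
  M.cohomology n

/-! ### Bisimplicial sets and homotopy colimits -/

/-- Bisimplicial sets. -/
abbrev BiSSet := SimplexCategoryᵒᵖ × SimplexCategoryᵒᵖ ⥤ Type u

/-- The diagonal of a bisimplicial set. -/
abbrev BiSSet.diag (X : BiSSet.{u}) : SSet.{u} := Functor.diag SimplexCategoryᵒᵖ ⋙ X

section HocolimDef

variable {D : Type u} [Category.{v} D]

/-- The simplicial replacement `N(D; F)` of `F : D ⥤ sSet`: its `(p, q)`-simplices are the pairs
`(σ, x)` with `σ = (d₀ ⟶ ⋯ ⟶ d_p)` in the nerve of `D` and `x ∈ F(d₀)_q`, and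
`(f, g)^* (σ, x) = (f^* σ, F(d₀ ⟶ d_{f(0)}) (g^* x))`. -/
def simplicialReplacement (F : D ⥤ SSet.{max u v}) : BiSSet.{max u v} where
  obj pq := Σ σ : (nerve D).obj pq.1, (F.obj (σ.obj 0)).obj pq.2
  map {pq pq'} f := ↾fun s =>
    ⟨(nerve D).map f.1 s.1,
      (F.map (s.1.map (homOfLE (Fin.zero_le (f.1.unop.toOrderHom 0))))).app pq'.2
        ((F.obj (s.1.obj 0)).map f.2 s.2)⟩
  map_id pq := by
    refine ConcreteCategory.hom_ext _ _ fun ⟨(σ : ComposableArrows D pq.1.unop.len), x⟩ => ?_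
    change (⟨σ, (F.map (σ.map (𝟙 0))).app pq.2 ((F.obj (σ.obj 0)).map (𝟙 pq.2) x)⟩ :
      Σ σ : ComposableArrows D pq.1.unop.len, (F.obj (σ.obj 0)).obj pq.2) = ⟨σ, x⟩
    simp
  map_comp {a b c} f g := by
    refine ConcreteCategory.hom_ext _ _ fun ⟨(σ : ComposableArrows D a.1.unop.len), x⟩ => ?_
    let u := homOfLE (Fin.zero_le (f.1.unop.toOrderHom 0))
    let v := homOfLE (f.1.unop.toOrderHom.monotone (Fin.zero_le (g.1.unop.toOrderHom 0)))
    refine congrArg (Sigma.mk ((nerve D).map g.1 ((nerve D).map f.1 σ))) ?_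
    change (F.map (σ.map (u ≫ v))).app c.2 ((F.obj (σ.obj 0)).map (f.2 ≫ g.2) x) =
      (F.map (σ.map v)).app c.2 ((F.obj (σ.obj (f.1.unop.toOrderHom 0))).map g.2
        ((F.map (σ.map u)).app b.2 ((F.obj (σ.obj 0)).map f.2 x)))
    simp [NatTrans.naturality_apply]

/-- The homotopy colimit of `F : D ⥤ sSet`. -/
def hocolimSSet (F : D ⥤ SSet.{max u v}) : SSet.{max u v} :=
  (simplicialReplacement F).diag

end HocolimDef

/-! ### The map `κ` -/

section Kappa

variable {C D : Type u} [Category.{v} C] [Category.{v} D] (φ : C ⥤ D)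

/-- The functor `d ↦ N(φ/d)` from `D` to simplicial sets. -/
def nerveComma : D ⥤ SSet.{max u v} :=
  CostructuredArrow.functor φ ⋙ nerveFunctor

/-- The map `j_d : N(φ/d) ⟶ N(C)` induced by the functor `φ/d ⥤ C`, `(c, μ) ↦ c`. -/
def nerveCommaProj (d : D) : (nerveComma φ).obj d ⟶ nerve C where
  app q := ↾fun (x : ComposableArrows (CostructuredArrow φ d) q.unop.len) =>
    x ⋙ CostructuredArrow.proj φ d

/-- The map `κ : hocolim_{d ∈ D} N(φ/d) ⟶ N(C)` induced by the maps `j_d`: on the simplex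
`(σ, x)` with `σ = (d₀ ⟶ ⋯ ⟶ dₙ)` and `x ∈ N(φ/d₀)ₙ` it takes the value `j_{d₀}(x)`. -/
def kappa : hocolimSSet (nerveComma φ) ⟶ nerve C where
  app n := ↾fun s => (nerveCommaProj φ (s.1.obj 0)).app n s.2
  naturality {m n} f := by
    ext ⟨σ, x⟩
    rfl

end Kappa

/-!
The proof is by dimension shifting.  Every coefficient system `M` for a simplicial set `Y` embeds into
the coinduced system `coind(M)`, `σ ↦ ∏_τ (Hom(σ, τ) → M(τ))`, and the long exact cohomology sequences
of `M → coind(M) → coind(M)/M` on `Y` and on `X` show by induction on the degree that `g : X ⟶ Y`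
induces isomorphisms for all coefficients as soon as it does so for coinduced ones
(`CoeffSystem.isIso_cohomologyMap_of_coind`).

For coinduced coefficients, a cochain of `X` is a family of cochains with constant coefficients `M(τ)`
on the pullbacks `W_τ = X ×_Y Δ[q]` of `g` along the simplices `τ : Δ[q] ⟶ Y`
(`CoeffSystem.SimplexPullbacks.comparison`).  Hence it is enough that all projections `W_τ ⟶ Δ[q]` are
simplicial homotopy equivalences (`CoeffSystem.SimplexPullbacks.isIso_cohomologyMap_coind`).

For `g = κ` and `τ = (c₀ ⟶ ⋯ ⟶ c_q)`, the `n`-simplices of `W_τ` are the triples of a map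
`a : [n] ⟶ [q]`, a simplex `d₀ ⟶ ⋯ ⟶ dₙ` of the nerve of `D` and a morphism `φ(c_{a(n)}) ⟶ d₀`.  Moving
the vertices `a(i)` to `0` is a homotopy from the identity to a retraction onto the nerve of the
category of objects under `φ(c₀)` (`CommaSimplex.toZeroHomotopy`), and this nerve contracts to the
initial object (`CommaSimplex.constHomotopy`).  So both `W_τ` and `Δ[q]` are contractible.
-/

/-! ### Simplicial homotopies and cochain complexes -/

section CosimplicialHomotopy

open AlgebraicTopology

variable {V : Type*} [Category* V] [Preadditive V]

/-- A cosimplicial object of `V`, seen as a simplicial object of `Vᵒᵖ`. -/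
def CategoryTheory.CosimplicialObject.opSimplicial (U : CosimplicialObject V) :
    SimplicialObject Vᵒᵖ :=
  Functor.op (C := SimplexCategory) (D := V) U

/-- The map of simplicial objects of `Vᵒᵖ` attached to a map of cosimplicial objects of `V`. -/
def CategoryTheory.CosimplicialObject.opSimplicialMap {U U' : CosimplicialObject V} (f : U ⟶ U') :
    U'.opSimplicial ⟶ U.opSimplicial :=
  NatTrans.op (C := SimplexCategory) (D := V) f

/-- The differentials of the chain complex in `Vᵒᵖ` and of the cochain complex in `V` agree. -/
lemma alternatingFaceMapComplex_opSimplicial_d (U : CosimplicialObject V) (n : ℕ) :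
    ((alternatingFaceMapComplex Vᵒᵖ).obj U.opSimplicial).d (n + 1) n =
      (((alternatingCofaceMapComplex V).obj U).d n (n + 1)).op := by
  have h : ((alternatingCofaceMapComplex V).obj U).d n (n + 1) =
      AlternatingCofaceMapComplex.objD U n :=
    CochainComplex.of_d (fun n => U.obj ⦋n⦌) (AlternatingCofaceMapComplex.objD U) n
  rw [alternatingFaceMapComplex_obj_d, h, AlternatingCofaceMapComplex.d_eq_unop_d]
  rfl

/-- The degreewise maps of the homotopy attached to a simplicial homotopy in `Vᵒᵖ`. -/
noncomputable def CategoryTheory.CosimplicialObject.homotopyHom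
    {U U' : CosimplicialObject V} {f g : U ⟶ U'}
    (H : SimplicialObject.Homotopy (CosimplicialObject.opSimplicialMap f)
      (CosimplicialObject.opSimplicialMap g)) (i j : ℕ) :
    ((alternatingCofaceMapComplex V).obj U).X i ⟶ ((alternatingCofaceMapComplex V).obj U').X j :=
  (H.toChainHomotopy.hom j i).unop

/-- A simplicial homotopy in `Vᵒᵖ` between two maps of cosimplicial objects of `V` induces a
homotopy between the maps of alternating coface complexes. -/
noncomputable def CategoryTheory.CosimplicialObject.homotopyOfOp
    {U U' : CosimplicialObject V} {f g : U ⟶ U'}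
    (H : SimplicialObject.Homotopy (CosimplicialObject.opSimplicialMap f)
      (CosimplicialObject.opSimplicialMap g)) :
    Homotopy ((alternatingCofaceMapComplex V).map f) ((alternatingCofaceMapComplex V).map g) where
  hom := CosimplicialObject.homotopyHom H
  zero i j hij := by
    rw [CosimplicialObject.homotopyHom, H.toChainHomotopy.zero j i hij]
    rfl
  comm n := by
    have h := H.toChainHomotopy.comm n
    cases n with
    | zero =>
      rw [prevD_eq (j' := 1) (w := by simp), dNext_eq_zero _ _ (by simp),
        alternatingFaceMapComplex_opSimplicial_d, zero_add] at h
      rw [dNext_eq (i' := 1) (w := by simp), prevD_eq_zero _ _ (by simp), add_zero]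
      exact congrArg Quiver.Hom.unop h
    | succ n =>
      rw [dNext_eq (i' := n) (w := by simp), prevD_eq (j' := n + 2) (w := by simp),
        alternatingFaceMapComplex_opSimplicial_d, alternatingFaceMapComplex_opSimplicial_d] at h
      rw [dNext_eq (i' := n + 2) (w := by simp), prevD_eq (j' := n) (w := by simp),
        add_comm (((alternatingCofaceMapComplex V).obj U).d _ _ ≫ _)]
      exact congrArg Quiver.Hom.unop h

end CosimplicialHomotopy

namespace SSet

/-- A simplicial homotopy from `f` to `g`, given by a map `h w t` natural in `n`, for `w ∈ Wₙ` and
`t : [n] ⟶ [1]`, which restricts to `f` and to `g` on the constant maps `t = 0` and `t = 1`. -/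
noncomputable def simplicialHomotopyOfNatural {W W' : SSet.{u}} {f g : W ⟶ W'}
    (h : ∀ (n : SimplexCategory), W.obj (op n) → (n ⟶ ⦋1⦌) → W'.obj (op n))
    (nat : ∀ {m n : SimplexCategory} (k : m ⟶ n) (x : W.obj (op n)) (t : n ⟶ ⦋1⦌),
      h m (W.map k.op x) (k ≫ t) = W'.map k.op (h n x t))
    (h₀ : ∀ (n : SimplexCategory) (x : W.obj (op n)) (t : n ⟶ ⦋1⦌),
      (∀ i, t.toOrderHom i = 0) → h n x t = f.app _ x)
    (h₁ : ∀ (n : SimplexCategory) (x : W.obj (op n)) (t : n ⟶ ⦋1⦌),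
      (∀ i, t.toOrderHom i = 1) → h n x t = g.app _ x) :
    SimplicialObject.Homotopy f g :=
  SSet.Homotopy.toSimplicialObjectHomotopy
    { h :=
        { app := fun n => ↾fun (x : W.obj n × (Δ[1] : SSet.{u}).obj n) =>
            h n.unop x.1 (SSet.stdSimplex.objEquiv x.2)
          naturality := by
            intro m n k
            ext ⟨x, t⟩
            exact nat k.unop x (SSet.stdSimplex.objEquiv t) }
      h₀ := by
        ext n x
        exact h₀ _ _ _ (fun i => rfl)
      h₁ := by
        ext n x
        exact h₁ _ _ _ (fun i => rfl)
      rel := by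
        ext n ⟨x, t⟩
        exact x.2.elim }

end SSet

section Families

variable {B : Type*} {W W' : B → SSet.{u}}

/-- A family of simplicial sets indexed by `B`, as a simplicial object of `B → Type u`. -/
def familySimplicial (W : B → SSet.{u}) : SimplicialObject (B → Type u) where
  obj n b := (W b).obj n
  map f b := (W b).map f

/-- A family of simplicial maps, as a map of simplicial objects of `B → Type u`. -/
def familySimplicialMap (f : ∀ b, W b ⟶ W' b) : familySimplicial W ⟶ familySimplicial W' where
  app n b := (f b).app n
  naturality _ _ k := funext fun b => (f b).naturality k

/-- A family of simplicial homotopies, as a homotopy between maps of simplicial objects of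
`B → Type u`. -/
def familyHomotopy {f g : ∀ b, W b ⟶ W' b} (H : ∀ b, SimplicialObject.Homotopy (f b) (g b)) :
    SimplicialObject.Homotopy (familySimplicialMap f) (familySimplicialMap g) where
  h i b := (H b).h i
  h_zero_comp_δ_zero n := funext fun b => (H b).h_zero_comp_δ_zero n
  h_last_comp_δ_last n := funext fun b => (H b).h_last_comp_δ_last n
  h_succ_comp_δ_castSucc_of_lt i j hij := funext fun b => (H b).h_succ_comp_δ_castSucc_of_lt i j hij
  h_succ_comp_δ_castSucc_succ j := funext fun b => (H b).h_succ_comp_δ_castSucc_succ j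
  h_castSucc_comp_δ_succ_of_lt i j hij := funext fun b => (H b).h_castSucc_comp_δ_succ_of_lt i j hij
  h_comp_σ_castSucc_of_le i j hij := funext fun b => (H b).h_comp_σ_castSucc_of_le i j hij
  h_comp_σ_succ_of_lt i j hij := funext fun b => (H b).h_comp_σ_succ_of_lt i j hij

end Families

/-! ### Cochains with constant coefficients on families of simplicial sets -/

section Functions

open AlgebraicTopology

variable {R : Type r} [CommRing R] {B : Type u} (A : B → Type w)
  [∀ b, AddCommGroup (A b)] [∀ b, Module R (A b)]

variable (R) in
/-- The contravariant functor sending a family of sets `S` over `B` to the module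
`∏_b (S b → A b)`, viewed as a covariant functor to the opposite of the category of modules. -/
def functionsFunctor : (B → Type u) ⥤ (ModuleCat.{max u w} R)ᵒᵖ where
  obj S := op (ModuleCat.of R (∀ b, S b → A b))
  map {_ S'} f := (ModuleCat.ofHom
    { toFun := fun (c : ∀ b, S' b → A b) b x => c b (f b x)
      map_add' := fun _ _ => rfl
      map_smul' := fun _ _ => rfl }).op
  map_id _ := rfl
  map_comp _ _ := rfl

variable (R) in
/-- The cosimplicial module `[n] ↦ ∏_b (W_b)ₙ → A b` of `A`-valued cochains on a family `W` of
simplicial sets. -/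
def functionsCosimplicial (W : B → SSet.{u}) : CosimplicialObject (ModuleCat.{max u w} R) where
  obj n := ModuleCat.of R (∀ b, (W b).obj (op n) → A b)
  map {m n} f := ModuleCat.ofHom
    { toFun := fun (c : ∀ b, (W b).obj (op m) → A b) b x => c b ((W b).map f.op x)
      map_add' := fun _ _ => rfl
      map_smul' := fun _ _ => rfl }
  map_id n := by
    ext c b x
    exact congrArg (c b) (by simp)
  map_comp f g := by
    ext c b x
    exact congrArg (c b) (by simp)

variable (R) in
/-- The map of cosimplicial modules induced by a family of simplicial maps. -/
def functionsCosimplicialMap {W W' : B → SSet.{u}} (f : ∀ b, W b ⟶ W' b) :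
    functionsCosimplicial R A W' ⟶ functionsCosimplicial R A W where
  app n := ModuleCat.ofHom
    { toFun := fun (c : ∀ b, (W' b).obj (op n) → A b) b x => c b ((f b).app (op n) x)
      map_add' := fun _ _ => rfl
      map_smul' := fun _ _ => rfl }
  naturality {m n} k := by
    ext c
    funext b x
    exact congrArg (c b) (by simp)

variable (R) in
/-- A family of simplicial homotopies induces a homotopy between the maps of cochain complexes. -/
noncomputable def functionsHomotopy {W W' : B → SSet.{u}} {f g : ∀ b, W b ⟶ W' b}
    (H : ∀ b, SimplicialObject.Homotopy (f b) (g b)) :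
    Homotopy ((alternatingCofaceMapComplex _).map (functionsCosimplicialMap R A f))
      ((alternatingCofaceMapComplex _).map (functionsCosimplicialMap R A g)) :=
  CosimplicialObject.homotopyOfOp ((familyHomotopy H).whiskerRight (functionsFunctor R A))

lemma functionsCosimplicialMap_id (W : B → SSet.{u}) :
    functionsCosimplicialMap R A (fun b => 𝟙 (W b)) = 𝟙 _ := rfl

lemma functionsCosimplicialMap_comp {W W' W'' : B → SSet.{u}} (f : ∀ b, W b ⟶ W' b)
    (f' : ∀ b, W' b ⟶ W'' b) :
    functionsCosimplicialMap R A (fun b => f b ≫ f' b) =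
      functionsCosimplicialMap R A f' ≫ functionsCosimplicialMap R A f := rfl

/-- A family of simplicial homotopy equivalences induces isomorphisms in the cohomology of the
cochains on the families. The homotopies `p s ∼ 1` and `s p ∼ e ∼ 1` are enough for this. -/
lemma isIso_homologyMap_functions {W W' : B → SSet.{u}} (p : ∀ b, W b ⟶ W' b)
    (s : ∀ b, W' b ⟶ W b) (e : ∀ b, W b ⟶ W b)
    (H : ∀ b, SimplicialObject.Homotopy (s b ≫ p b) (𝟙 (W' b)))
    (K : ∀ b, SimplicialObject.Homotopy (p b ≫ s b) (e b))
    (K' : ∀ b, SimplicialObject.Homotopy (e b) (𝟙 (W b))) (n : ℕ) :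
    IsIso (HomologicalComplex.homologyMap ((alternatingCofaceMapComplex _).map
      (functionsCosimplicialMap R A p)) n) := by
  refine ⟨HomologicalComplex.homologyMap ((alternatingCofaceMapComplex _).map
      (functionsCosimplicialMap R A s)) n, ?_, ?_⟩
  · rw [← HomologicalComplex.homologyMap_comp, ← Functor.map_comp,
      ← functionsCosimplicialMap_comp, (functionsHomotopy R A H).homologyMap_eq,
      functionsCosimplicialMap_id, CategoryTheory.Functor.map_id, HomologicalComplex.homologyMap_id]
  · rw [← HomologicalComplex.homologyMap_comp, ← Functor.map_comp,
      ← functionsCosimplicialMap_comp, (functionsHomotopy R A K).homologyMap_eq,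
      (functionsHomotopy R A K').homologyMap_eq,
      functionsCosimplicialMap_id, CategoryTheory.Functor.map_id, HomologicalComplex.homologyMap_id]

end Functions

/-! ### Four lemmas for the first term of a short exact sequence -/

section FourLemmas

open HomologicalComplex HomologicalComplex.HomologySequence ComposableArrows Abelian

variable {𝒜 : Type*} [Category* 𝒜] [Abelian 𝒜] {S₁ S₂ : ShortComplex (CochainComplex 𝒜 ℕ)}
  (ψ : S₁ ⟶ S₂)

lemma mono_homologyMap_τ₁_zero (hS₁ : S₁.ShortExact)
    (h₂ : Mono (homologyMap ψ.τ₂ 0)) :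
    Mono (homologyMap ψ.τ₁ 0) := by
  have := hS₁.mono_f
  have := mono_homologyMap_of_mono_of_not_rel S₁.f 0 (by simp)
  have h : homologyMap ψ.τ₁ 0 ≫ homologyMap S₂.f 0 =
      homologyMap S₁.f 0 ≫ homologyMap ψ.τ₂ 0 := by
    rw [← homologyMap_comp, ← homologyMap_comp, ψ.comm₁₂]
  exact mono_of_mono_fac h

lemma mono_homologyMap_τ₁_succ (hS₁ : S₁.ShortExact) (hS₂ : S₂.ShortExact) (n : ℕ)
    (h₂ : Epi (homologyMap ψ.τ₂ n))
    (h₃ : Mono (homologyMap ψ.τ₃ n)) (h₂' : Mono (homologyMap ψ.τ₂ (n + 1))) :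
    Mono (homologyMap ψ.τ₁ (n + 1)) :=
  mono_of_epi_of_mono_of_mono
    ((δ₀Functor ⋙ δlastFunctor).map (mapComposableArrows₅ ψ hS₁ hS₂ n (n + 1) rfl))
    (composableArrows₅_exact hS₁ n (n + 1) rfl).δ₀.δlast
    (composableArrows₅_exact hS₂ n (n + 1) rfl).δ₀.δlast h₂ h₃ h₂'

lemma epi_homologyMap_τ₁_zero (hS₁ : S₁.ShortExact) (hS₂ : S₂.ShortExact)
    (h₂ : Epi (homologyMap ψ.τ₂ 0))
    (h₃ : Mono (homologyMap ψ.τ₃ 0)) : Epi (homologyMap ψ.τ₁ 0) := by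
  have := hS₂.mono_f
  have := mono_homologyMap_of_mono_of_not_rel S₂.f 0 (by simp)
  exact Abelian.epi_of_mono_of_epi_of_mono (mapComposableArrows₂ ψ 0)
    (composableArrows₂_exact hS₁ 0) (composableArrows₂_exact hS₂ 0) this h₂ h₃

lemma epi_homologyMap_τ₁_succ (hS₁ : S₁.ShortExact) (hS₂ : S₂.ShortExact) (n : ℕ)
    (h₃ : Epi (homologyMap ψ.τ₃ n))
    (h₂ : Epi (homologyMap ψ.τ₂ (n + 1))) (h₃' : Mono (homologyMap ψ.τ₃ (n + 1))) :
    Epi (homologyMap ψ.τ₁ (n + 1)) :=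
  epi_of_epi_of_epi_of_mono
    ((δ₀Functor ⋙ δ₀Functor).map (mapComposableArrows₅ ψ hS₁ hS₂ n (n + 1) rfl))
    (composableArrows₅_exact hS₁ n (n + 1) rfl).δ₀.δ₀
    (composableArrows₅_exact hS₂ n (n + 1) rfl).δ₀.δ₀ h₃ h₂ h₃'

end FourLemmas

/-! ### Coinduced coefficient systems and dimension shifting -/

namespace CoeffSystem

open AlgebraicTopology

variable {R : Type r} [CommRing R] {X Y : SSet.{u}}

/-- The coinduced coefficient system `σ ↦ ∏_τ (Hom(σ, τ) → M(τ))`, the product being over all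
simplices `τ`. -/
def coind (M : CoeffSystem.{w} R Y) : CoeffSystem.{max u w} R Y where
  obj σ := ModuleCat.of R (∀ τ : SimplexCat Y, (σ ⟶ τ) → M.obj τ)
  map {σ σ'} f := ModuleCat.ofHom
    { toFun := fun (c : ∀ τ : SimplexCat Y, (σ ⟶ τ) → M.obj τ) τ a => c τ (f ≫ a)
      map_add' := fun _ _ => rfl
      map_smul' := fun _ _ => rfl }
  map_id σ := by
    ext c τ a
    exact congrArg (c τ) (Category.id_comp a)
  map_comp f g := by
    ext c τ a
    exact congrArg (c τ) (Category.assoc f g a)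

/-- The embedding `M(σ) → coind(M)(σ)`, `x ↦ (a ↦ M(a) x)`. -/
def toCoind (M : CoeffSystem.{w} R Y) (σ : SimplexCat Y) : M.obj σ →ₗ[R] M.coind.obj σ where
  toFun x := fun τ a => M.map a x
  map_add' x y := by
    funext τ a
    exact map_add (M.map a).hom x y
  map_smul' c x := by
    funext τ a
    exact map_smul (M.map a).hom c x

lemma toCoind_injective (M : CoeffSystem.{w} R Y) (σ : SimplexCat Y) :
    Function.Injective (M.toCoind σ) := by
  intro x y h
  have := congrFun (congrFun h σ) (𝟙 σ)
  change M.map (𝟙 σ) x = M.map (𝟙 σ) y at this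
  simpa using this

lemma toCoind_naturality (M : CoeffSystem.{w} R Y) {σ σ' : SimplexCat Y} (f : σ ⟶ σ')
    (x : M.obj σ) : M.toCoind σ' (M.map f x) = M.coind.map f (M.toCoind σ x) := by
  funext τ a
  change M.map a (M.map f x) = M.map (f ≫ a) x
  simp

/-- The quotient of the coinduced coefficient system by `M`. -/
def coindQuot (M : CoeffSystem.{w} R Y) : CoeffSystem.{max u w} R Y where
  obj σ := ModuleCat.of R (M.coind.obj σ ⧸ LinearMap.range (M.toCoind σ))
  map {σ σ'} f := ModuleCat.ofHom (Submodule.mapQ _ _ (M.coind.map f).hom (by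
    rintro _ ⟨x, rfl⟩
    exact ⟨M.map f x, M.toCoind_naturality f x⟩))
  map_id σ := by
    ext x
    simp
  map_comp f g := by
    ext x
    simp

/-- A natural family of linear maps `M(σ) → N(σ)` induces a map of cosimplicial modules. The
modules `M(σ)` and `N(σ)` may live in different universes. -/
def cosimplicialCoeffMap {M : CoeffSystem.{w} R X} {N : CoeffSystem.{max u w} R X}
    (θ : ∀ σ, M.obj σ →ₗ[R] N.obj σ)
    (hθ : ∀ {σ σ' : SimplexCat X} (f : σ ⟶ σ') (x : M.obj σ),
      θ σ' (M.map f x) = N.map f (θ σ x)) :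
    M.cosimplicial ⟶ N.cosimplicial where
  app n := ModuleCat.ofHom
    { toFun := fun (c : M.Cochain n) σ => θ _ (c σ)
      map_add' := fun c c' => funext fun σ => map_add (θ _) (c σ) (c' σ)
      map_smul' := fun a c => funext fun σ => map_smul (θ _) a (c σ) }
  naturality {m n} f := by
    ext c
    funext (σ : X.obj (op n))
    exact hθ _ _

/-- A pointwise short exact sequence `M → N → Q` of coefficient systems.  The modules `M(σ)` may
live in a smaller universe than the other ones. -/
structure CoeffSES (M : CoeffSystem.{w} R X) (N Q : CoeffSystem.{max u w} R X) where
  /-- the maps `M(σ) → N(σ)` -/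
  ι (σ : SimplexCat X) : M.obj σ →ₗ[R] N.obj σ
  ι_naturality {σ σ' : SimplexCat X} (f : σ ⟶ σ') (x : M.obj σ) :
    ι σ' (M.map f x) = N.map f (ι σ x)
  /-- the maps `N(σ) → Q(σ)` -/
  π (σ : SimplexCat X) : N.obj σ →ₗ[R] Q.obj σ
  π_naturality {σ σ' : SimplexCat X} (f : σ ⟶ σ') (x : N.obj σ) :
    π σ' (N.map f x) = Q.map f (π σ x)
  injective (σ : SimplexCat X) : Function.Injective (ι σ)
  exact (σ : SimplexCat X) : Function.Exact (ι σ) (π σ)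
  surjective (σ : SimplexCat X) : Function.Surjective (π σ)

namespace CoeffSES

/-- The short exact sequence `M → coind(M) → coind(M)/M`. -/
def coind (M : CoeffSystem.{w} R Y) : CoeffSES M M.coind M.coindQuot where
  ι := M.toCoind
  ι_naturality := M.toCoind_naturality
  π _ := Submodule.mkQ _
  π_naturality _ _ := rfl
  injective := M.toCoind_injective
  exact σ := LinearMap.exact_map_mkQ_range (M.toCoind σ)
  surjective _ := Submodule.mkQ_surjective _

/-- The pulled back short exact sequence. -/
def pullback (g : X ⟶ Y) {M : CoeffSystem.{w} R Y} {N Q : CoeffSystem.{max u w} R Y}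
    (S : CoeffSES M N Q) : CoeffSES (CoeffSystem.pullback g M) (CoeffSystem.pullback g N)
      (CoeffSystem.pullback g Q) where
  ι _ := S.ι _
  ι_naturality _ x := S.ι_naturality _ x
  π _ := S.π _
  π_naturality _ x := S.π_naturality _ x
  injective _ := S.injective _
  exact _ := S.exact _
  surjective _ := S.surjective _

variable {M : CoeffSystem.{w} R X} {N Q : CoeffSystem.{max u w} R X} (S : CoeffSES M N Q)

/-- The sequence of cochain complexes. -/
noncomputable def cochainSequence : ShortComplex (CochainComplex (ModuleCat.{max u w} R) ℕ) where
  X₁ := M.cochainComplex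
  X₂ := N.cochainComplex
  X₃ := Q.cochainComplex
  f := (alternatingCofaceMapComplex _).map (cosimplicialCoeffMap S.ι S.ι_naturality)
  g := (alternatingCofaceMapComplex _).map (cosimplicialCoeffMap S.π S.π_naturality)
  zero := by
    ext n c
    funext σ
    exact (S.exact _).apply_apply_eq_zero _

lemma shortExact_cochainSequence : S.cochainSequence.ShortExact := by
  refine HomologicalComplex.shortExact_of_degreewise_shortExact _ fun n => ?_
  refine ModuleCat.shortComplex_shortExact _ ?_ ?_ ?_
  · rintro (x : N.Cochain ⦋n⦌)
    constructor
    · intro h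
      have h' (σ) : ∃ y, S.ι (SimplexCat.mk σ) y = x σ := (S.exact _ _).1 (congrFun h σ)
      choose y hy using h'
      exact ⟨(y : M.Cochain ⦋n⦌), funext hy⟩
    · rintro ⟨y, rfl⟩
      funext σ
      exact (S.exact _).apply_apply_eq_zero _
  · intro (x : M.Cochain ⦋n⦌) (y : M.Cochain ⦋n⦌) h
    funext σ
    exact S.injective _ (congrFun h σ)
  · intro (x : Q.Cochain ⦋n⦌)
    choose y hy using fun σ => S.surjective (SimplexCat.mk σ) (x σ)
    exact ⟨(y : N.Cochain ⦋n⦌), funext hy⟩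

/-- The map of sequences of cochain complexes induced by a simplicial map. -/
noncomputable def cochainSequenceMap (g : X ⟶ Y) {M : CoeffSystem.{w} R Y}
    {N Q : CoeffSystem.{max u w} R Y} (S : CoeffSES M N Q) :
    S.cochainSequence ⟶ (S.pullback g).cochainSequence where
  τ₁ := cochainMap g M
  τ₂ := cochainMap g N
  τ₃ := cochainMap g Q
  comm₁₂ := by
    ext n : 1
    rfl
  comm₂₃ := by
    ext n : 1
    rfl

end CoeffSES

variable (g : X ⟶ Y)

/-- Dimension shifting along `M → coind(M) → Q`: injectivity in degree `n` follows from the case of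
`Q` in smaller degrees. -/
lemma mono_cohomologyMap_of_coind {M : CoeffSystem.{w} R Y}
    (hI : ∀ n, IsIso (cohomologyMap g M.coind n)) (n : ℕ)
    (hQ : ∀ m < n, IsIso (cohomologyMap g M.coindQuot m)) : Mono (cohomologyMap g M n) := by
  let ψ := CoeffSES.cochainSequenceMap g (CoeffSES.coind M)
  have h₁ := (CoeffSES.coind M).shortExact_cochainSequence
  have h₂ := ((CoeffSES.coind M).pullback g).shortExact_cochainSequence
  have hI' (n : ℕ) : IsIso (HomologicalComplex.homologyMap ψ.τ₂ n) := hI n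
  cases n with
  | zero => exact mono_homologyMap_τ₁_zero ψ h₁ inferInstance
  | succ n =>
    have : IsIso (HomologicalComplex.homologyMap ψ.τ₃ n) := hQ n n.lt_succ_self
    exact mono_homologyMap_τ₁_succ ψ h₁ h₂ n inferInstance inferInstance inferInstance

/-- Dimension shifting along `M → coind(M) → Q`: surjectivity in degree `n` also needs injectivity
for `Q` in degree `n`. -/
lemma epi_cohomologyMap_of_coind {M : CoeffSystem.{w} R Y}
    (hI : ∀ n, IsIso (cohomologyMap g M.coind n)) (n : ℕ)
    (hQ : ∀ m < n, IsIso (cohomologyMap g M.coindQuot m))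
    (hQn : Mono (cohomologyMap g M.coindQuot n)) : Epi (cohomologyMap g M n) := by
  let ψ := CoeffSES.cochainSequenceMap g (CoeffSES.coind M)
  have h₁ := (CoeffSES.coind M).shortExact_cochainSequence
  have h₂ := ((CoeffSES.coind M).pullback g).shortExact_cochainSequence
  have hI' (n : ℕ) : IsIso (HomologicalComplex.homologyMap ψ.τ₂ n) := hI n
  cases n with
  | zero => exact epi_homologyMap_τ₁_zero ψ h₁ h₂ inferInstance hQn
  | succ n =>
    have : IsIso (HomologicalComplex.homologyMap ψ.τ₃ n) := hQ n n.lt_succ_self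
    exact epi_homologyMap_τ₁_succ ψ h₁ h₂ n inferInstance inferInstance hQn

/-- The induction on the degree passes from `M` to `Q`, hence needs a universe which is stable under
the formation of coinduced coefficient systems. -/
lemma isIso_cohomologyMap_of_coind_large
    (hI : ∀ (M : CoeffSystem.{max u w} R Y) n, IsIso (cohomologyMap g M.coind n)) (n : ℕ) :
    ∀ M : CoeffSystem.{max u w} R Y, IsIso (cohomologyMap g M n) := by
  induction n using Nat.strong_induction_on with
  | _ n ih =>
    have hmono (M : CoeffSystem.{max u w} R Y) : Mono (cohomologyMap g M n) :=
      mono_cohomologyMap_of_coind.{max u w} g (hI M) n fun m hm => ih m hm _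
    intro M
    have := hmono M
    have := epi_cohomologyMap_of_coind.{max u w} g (hI M) n (fun m hm => ih m hm _) (hmono _)
    exact isIso_of_mono_of_epi _

/-- If `g` induces isomorphisms in cohomology with coinduced coefficients, then it does so with all
coefficients. -/
lemma isIso_cohomologyMap_of_coind
    (hI : ∀ (M : CoeffSystem.{w} R Y) n, IsIso (cohomologyMap g M.coind n))
    (hI' : ∀ (M : CoeffSystem.{max u w} R Y) n, IsIso (cohomologyMap g M.coind n)) (n : ℕ)
    (M : CoeffSystem.{w} R Y) : IsIso (cohomologyMap g M n) := by
  have hQ (m : ℕ) := isIso_cohomologyMap_of_coind_large.{w} g hI' m M.coindQuot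
  have := mono_cohomologyMap_of_coind g (hI M) n fun m _ => hQ m
  have := epi_cohomologyMap_of_coind g (hI M) n (fun m _ => hQ m) inferInstance
  exact isIso_of_mono_of_epi _

end CoeffSystem

/-! ### Cohomology with coinduced coefficients -/

namespace CoeffSystem

open AlgebraicTopology

variable {R : Type r} [CommRing R] {X Y : SSet.{u}}

/-- The simplicial map `Δ[q] ⟶ Y` classifying a `q`-simplex. -/
def classify (τ : SimplexCat Y) : SSet.stdSimplex.obj τ.unop.1.unop ⟶ Y :=
  SSet.yonedaEquiv.symm τ.unop.2

/-- Simplicial sets `W_τ` with maps to `X` and to `Δ[q]` which exhibit `W_τ` as the pullback of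
`g : X ⟶ Y` along the simplex `τ : Δ[q] ⟶ Y`, for all simplices `τ` of `Y`. -/
structure SimplexPullbacks (g : X ⟶ Y) where
  /-- the pullback along `τ` -/
  W : SimplexCat Y → SSet.{u}
  /-- the projection to `X` -/
  fst (τ : SimplexCat Y) : W τ ⟶ X
  /-- the projection to the standard simplex -/
  snd (τ : SimplexCat Y) : W τ ⟶ SSet.stdSimplex.obj τ.unop.1.unop
  condition (τ : SimplexCat Y) (n : SimplexCategory) (x : (W τ).obj (op n)) :
    (classify τ).app (op n) ((snd τ).app (op n) x) = g.app (op n) ((fst τ).app (op n) x)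
  existsUnique (τ : SimplexCat Y) (n : SimplexCategory) (s : X.obj (op n))
    (a : (SSet.stdSimplex.obj τ.unop.1.unop).obj (op n))
    (h : (classify τ).app (op n) a = g.app (op n) s) :
    ∃! x : (W τ).obj (op n), (fst τ).app (op n) x = s ∧ (snd τ).app (op n) x = a

/-- A cochain with coinduced coefficients takes the same value on two equal simplices and two
morphisms to `τ` with the same underlying map of the simplex category. -/
lemma coind_section_congr (M : CoeffSystem.{w} R Y) (g : X ⟶ Y) {n : SimplexCategory}
    (c : (pullback g M.coind).Cochain n) {s s' : X.obj (op n)} (hs : s = s') (τ : SimplexCat Y)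
    (a : (SimplexCat.map g).obj (SimplexCat.mk s) ⟶ τ)
    (a' : (SimplexCat.map g).obj (SimplexCat.mk s') ⟶ τ) (ha : a.unop.val = a'.unop.val) :
    (c s : ∀ τ : SimplexCat Y, ((SimplexCat.map g).obj (SimplexCat.mk s) ⟶ τ) → M.obj τ) τ a =
    (c s' : ∀ τ : SimplexCat Y, ((SimplexCat.map g).obj (SimplexCat.mk s') ⟶ τ) → M.obj τ) τ a' := by
  subst hs
  have : a = a' := Quiver.Hom.unop_inj (CategoryOfElements.ext _ _ _ ha)
  rw [this]

namespace SimplexPullbacks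

variable {g : X ⟶ Y} (P : SimplexPullbacks g) (M : CoeffSystem.{w} R Y)

/-- A simplex of `W_τ` is a simplex of `X` together with a morphism from its image in `Y` to `τ`. -/
def hom {τ : SimplexCat Y} {n : SimplexCategory} (x : (P.W τ).obj (op n)) :
    (SimplexCat.map g).obj (SimplexCat.mk ((P.fst τ).app (op n) x)) ⟶ τ :=
  Quiver.Hom.op ⟨(SSet.stdSimplex.objEquiv ((P.snd τ).app (op n) x)).op, P.condition τ n x⟩

/-- Cochains of `X` with coefficients in `g^* coind(M)` are families of cochains of the simplicial
sets `W_τ` with constant coefficients `M(τ)`. -/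
def comparison : (pullback g M.coind).cosimplicial ⟶
    functionsCosimplicial R (fun τ => M.obj τ) P.W where
  app n := ModuleCat.ofHom
    { toFun := fun (c : (pullback g M.coind).Cochain n) τ x =>
        (c ((P.fst τ).app (op n) x) : ∀ τ : SimplexCat Y,
          ((SimplexCat.map g).obj (SimplexCat.mk _) ⟶ τ) → M.obj τ) τ (P.hom x)
      map_add' := fun _ _ => rfl
      map_smul' := fun _ _ => rfl }
  naturality {m n} f := by
    ext c
    funext τ x
    exact coind_section_congr M g c (by simp) _ _ _ <| by
      change _ = (SSet.stdSimplex.objEquiv ((P.snd τ).app _ ((P.W τ).map f.op x))).op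
      rw [NatTrans.naturality_apply]
      rfl

lemma comparison_bijective (n : SimplexCategory) :
    Function.Bijective ((P.comparison M).app n).hom := by
  constructor
  · intro (c : (pullback g M.coind).Cochain n) (c' : (pullback g M.coind).Cochain n) h
    funext s τ a
    obtain ⟨x, ⟨rfl, hx⟩, -⟩ := P.existsUnique τ n s
      (SSet.stdSimplex.objEquiv.symm a.unop.val.unop) a.unop.property
    have ha : a = P.hom x := by
      apply Quiver.Hom.unop_inj
      apply CategoryOfElements.ext
      change a.unop.val = (SSet.stdSimplex.objEquiv ((P.snd τ).app (op n) x)).op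
      rw [hx]
      rfl
    rw [ha]
    exact congrFun (congrFun h τ) x
  · intro (b : ∀ τ, (P.W τ).obj (op n) → M.obj τ)
    let x (s : X.obj (op n)) (τ : SimplexCat Y)
      (a : (SimplexCat.map g).obj (SimplexCat.mk s) ⟶ τ) :=
      (P.existsUnique τ n s (SSet.stdSimplex.objEquiv.symm a.unop.val.unop) a.unop.property).choose
    refine ⟨(fun s τ a => b τ (x s τ a) : (pullback g M.coind).Cochain n), ?_⟩
    funext τ y
    refine congrArg (b τ) ?_
    exact ((P.existsUnique τ n _ _ (P.hom y).unop.property).choose_spec.2 y ⟨rfl, rfl⟩).symm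

instance : IsIso (P.comparison M) := by
  have (n : SimplexCategory) : IsIso ((P.comparison M).app n) :=
    (ConcreteCategory.isIso_iff_bijective _).2 (P.comparison_bijective M n)
  exact NatIso.isIso_of_isIso_app (F := (pullback g M.coind).cosimplicial)
    (G := functionsCosimplicial R (fun τ => M.obj τ) P.W) (P.comparison M)

end SimplexPullbacks

/-- The standard simplices are the pullbacks of the identity. -/
def simplexPullbacksId (Y : SSet.{u}) : SimplexPullbacks (𝟙 Y) where
  W τ := SSet.stdSimplex.obj τ.unop.1.unop
  fst := classify
  snd _ := 𝟙 _
  condition _ _ _ := rfl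
  existsUnique _ _ _ a h := ⟨a, ⟨h, rfl⟩, fun _ h => h.2⟩

instance (N : CoeffSystem.{w} R Y) : IsIso (cosimplicialMap (𝟙 Y) N) := by
  have (n : SimplexCategory) : IsIso ((cosimplicialMap (𝟙 Y) N).app n) :=
    (ConcreteCategory.isIso_iff_bijective _).2 Function.bijective_id
  exact NatIso.isIso_of_isIso_app (F := N.cosimplicial) (G := (pullback (𝟙 Y) N).cosimplicial)
    (cosimplicialMap (𝟙 Y) N)

lemma SimplexPullbacks.comparison_comm {g : X ⟶ Y} (P : SimplexPullbacks g)
    (M : CoeffSystem.{w} R Y) :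
    cosimplicialMap g M.coind ≫ P.comparison M =
      (cosimplicialMap (𝟙 Y) M.coind ≫ (simplexPullbacksId Y).comparison M) ≫
        functionsCosimplicialMap R (fun τ => M.obj τ) P.snd := by
  ext n c
  funext τ x
  refine coind_section_congr M (𝟙 Y) c (P.condition τ n x).symm _ _ _ rfl

/-- If the projections `X ×_Y Δ[q] ⟶ Δ[q]` are simplicial homotopy equivalences, then `g` induces
isomorphisms in cohomology with coinduced coefficients. -/
lemma SimplexPullbacks.isIso_cohomologyMap_coind {g : X ⟶ Y} (P : SimplexPullbacks g)
    (s : ∀ τ, SSet.stdSimplex.obj τ.unop.1.unop ⟶ P.W τ) (e : ∀ τ, P.W τ ⟶ P.W τ)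
    (H : ∀ τ, SimplicialObject.Homotopy (s τ ≫ P.snd τ) (𝟙 _))
    (K : ∀ τ, SimplicialObject.Homotopy (P.snd τ ≫ s τ) (e τ))
    (K' : ∀ τ, SimplicialObject.Homotopy (e τ) (𝟙 (P.W τ)))
    (M : CoeffSystem.{w} R Y) (n : ℕ) : IsIso (cohomologyMap g M.coind n) := by
  have h₁ := isIso_homologyMap_functions (R := R) (fun τ => M.obj τ) P.snd s e H K K' n
  let 𝓗 := alternatingCofaceMapComplex (ModuleCat.{max u w} R) ⋙
    HomologicalComplex.homologyFunctor _ _ n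
  have h₂ : IsIso (𝓗.map (functionsCosimplicialMap R (fun τ => M.obj τ) P.snd)) := h₁
  have h₃ : IsIso (𝓗.map (cosimplicialMap g M.coind ≫ P.comparison M)) := by
    have h₄ : IsIso (cosimplicialMap (𝟙 Y) M.coind ≫ (simplexPullbacksId Y).comparison M) :=
      IsIso.comp_isIso' inferInstance inferInstance
    rw [P.comparison_comm M, 𝓗.map_comp]
    exact IsIso.comp_isIso' (Functor.map_isIso 𝓗 _) h₂
  rw [𝓗.map_comp] at h₃
  exact IsIso.of_isIso_comp_right (𝓗.map (cosimplicialMap g M.coind)) (𝓗.map (P.comparison M))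

end CoeffSystem

/-! ### Homotopies of standard simplices and of nerves -/

section Mix

/-- The map `i ↦ 0` if `t i = 0`, and `i ↦ a i` otherwise. -/
def mixZero {n q : SimplexCategory} (a : n ⟶ q) (t : n ⟶ ⦋1⦌) : n ⟶ q :=
  SimplexCategory.Hom.mk
    { toFun := fun i => if t.toOrderHom i = 0 then 0 else a.toOrderHom i
      monotone' := by
        intro i j hij
        have h := t.toOrderHom.monotone hij
        dsimp only
        split_ifs with h₁ h₂ h₂
        · exact le_rfl
        · exact Fin.zero_le _
        · exact absurd (le_antisymm (h.trans h₂.le) (Fin.zero_le _)) h₁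
        · exact a.toOrderHom.monotone hij }

lemma mixZero_apply {n q : SimplexCategory} (a : n ⟶ q) (t : n ⟶ ⦋1⦌) (i : Fin (n.len + 1)) :
    (mixZero a t).toOrderHom i = if t.toOrderHom i = 0 then 0 else a.toOrderHom i := rfl

lemma mixZero_le {n q : SimplexCategory} (a : n ⟶ q) (t : n ⟶ ⦋1⦌) (i : Fin (n.len + 1)) :
    (mixZero a t).toOrderHom i ≤ a.toOrderHom i := by
  rw [mixZero_apply]
  split_ifs
  · exact Fin.zero_le _
  · exact le_rfl

/-- The constant map with value `0`. -/
def constZero (n q : SimplexCategory) : n ⟶ q :=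
  SimplexCategory.Hom.mk ⟨fun _ => 0, monotone_const⟩

lemma mixZero_eq_constZero {n q : SimplexCategory} (a : n ⟶ q) (t : n ⟶ ⦋1⦌)
    (ht : ∀ i, t.toOrderHom i = 0) : mixZero a t = constZero n q := by
  ext i : 3
  exact if_pos (ht i)

lemma mixZero_eq_self {n q : SimplexCategory} (a : n ⟶ q) (t : n ⟶ ⦋1⦌)
    (ht : ∀ i, t.toOrderHom i = 1) : mixZero a t = a := by
  ext i : 3
  exact if_neg (by rw [ht i]; exact one_ne_zero)

/-- The constant map `Δ[q] ⟶ Δ[q]` at the vertex `0`. -/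
def stdSimplexConstZero (q : SimplexCategory) :
    SSet.stdSimplex.{u}.obj q ⟶ SSet.stdSimplex.obj q where
  app n := ↾fun _ => SSet.stdSimplex.objEquiv.symm (constZero n.unop q)

/-- `Δ[q]` contracts to the vertex `0`. -/
noncomputable def stdSimplexContraction (q : SimplexCategory) :
    SimplicialObject.Homotopy (stdSimplexConstZero.{u} q) (𝟙 _) :=
  SSet.simplicialHomotopyOfNatural
    (fun _ a t => SSet.stdSimplex.objEquiv.symm (mixZero (SSet.stdSimplex.objEquiv a) t))
    (fun _ _ _ => rfl)
    (fun _ _ t ht => congrArg SSet.stdSimplex.objEquiv.symm (mixZero_eq_constZero _ t ht))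
    (fun _ _ t ht => congrArg SSet.stdSimplex.objEquiv.symm (mixZero_eq_self _ t ht))

end Mix

section Nerve

variable {E : Type u} [Category.{v} E] {F G : E ⥤ E}

/-- The functor `[1] × E ⥤ E` attached to a natural transformation. -/
def natTransCylinder (α : F ⟶ G) : Fin 2 × E ⥤ E :=
  Functor.uncurry.obj (ComposableArrows.mk₁ α)

lemma prod'_comp_natTransCylinder (α : F ⟶ G) {n : SimplexCategory}
    (x : ComposableArrows E n.len) (t : n ⟶ ⦋1⦌) (b : Fin 2) (ht : ∀ i, t.toOrderHom i = b) :
    Functor.prod' t.toOrderHom.monotone.functor x ⋙ natTransCylinder α =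
      x ⋙ (ComposableArrows.mk₁ α).obj b := by
  obtain rfl : t = SimplexCategory.Hom.mk ⟨fun _ => b, monotone_const⟩ := by
    ext i : 3
    exact ht i
  refine CategoryTheory.Functor.ext (fun _ => rfl) fun i j f => ?_
  change ((ComposableArrows.mk₁ α).map (𝟙 b)).app _ ≫ ((ComposableArrows.mk₁ α).obj b).map _ = _
  rw [CategoryTheory.Functor.map_id, NatTrans.id_app]
  exact (Category.id_comp _).trans ((Category.id_comp _).trans (Category.comp_id _)).symm

/-- A natural transformation `F ⟶ G` induces a simplicial homotopy between the maps of nerves. -/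
noncomputable def nerveHomotopy (α : F ⟶ G) :
    SimplicialObject.Homotopy (nerveMap F) (nerveMap G) :=
  SSet.simplicialHomotopyOfNatural
    (fun n (x : ComposableArrows E n.len) t =>
      (Functor.prod' t.toOrderHom.monotone.functor x ⋙ natTransCylinder α :
        ComposableArrows E n.len))
    (fun _ _ _ => rfl)
    (fun _ x t ht => prod'_comp_natTransCylinder α x t 0 ht)
    (fun _ x t ht => prod'_comp_natTransCylinder α x t 1 ht)

end Nerve

/-! ### The pullbacks of `κ` along simplices -/

section Comma

variable {C D : Type u} [Category.{v} C] [Category.{v} D] (φ : C ⥤ D) {q : SimplexCategory}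
  (τ : ComposableArrows C q.len)

/-- An `n`-simplex of the pullback of `κ` along a simplex `τ = (c₀ ⟶ ⋯ ⟶ c_q)` of the nerve of `C`:
a map `a : [n] ⟶ [q]`, a simplex `σ = (d₀ ⟶ ⋯ ⟶ dₙ)` of the nerve of `D` and a morphism
`φ(c_{a(n)}) ⟶ d₀`. -/
structure CommaSimplex (n : SimplexCategory) : Type (max u v) where
  /-- the map to the standard simplex -/
  a : n ⟶ q
  /-- the simplex `d₀ ⟶ ⋯ ⟶ dₙ` -/
  σ : ComposableArrows D n.len
  /-- the morphism `φ(c_{a(n)}) ⟶ d₀` -/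
  μ : φ.obj (τ.obj (a.toOrderHom (Fin.last n.len))) ⟶ σ.obj 0

namespace CommaSimplex

variable {φ τ}

/-- The simplex with `a` replaced by a map `b` with `b(n) ≤ a(n)`. -/
def restrict {n : SimplexCategory} (x : CommaSimplex φ τ n) (b : n ⟶ q)
    (hb : b.toOrderHom (Fin.last n.len) ≤ x.a.toOrderHom (Fin.last n.len)) :
    CommaSimplex φ τ n where
  a := b
  σ := x.σ
  μ := φ.map (τ.map (homOfLE hb)) ≫ x.μ

lemma restrict_congr {n : SimplexCategory} (x : CommaSimplex φ τ n) {b b' : n ⟶ q} (h : b = b')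
    (hb : b.toOrderHom (Fin.last n.len) ≤ x.a.toOrderHom (Fin.last n.len))
    (hb' : b'.toOrderHom (Fin.last n.len) ≤ x.a.toOrderHom (Fin.last n.len)) :
    x.restrict b hb = x.restrict b' hb' := by
  subst h
  rfl

lemma restrict_self {n : SimplexCategory} (x : CommaSimplex φ τ n) :
    x.restrict x.a le_rfl = x := by
  obtain ⟨a, σ, μ⟩ := x
  refine congrArg (CommaSimplex.mk a σ) ?_
  change φ.map (τ.map (𝟙 _)) ≫ μ = μ
  simp

/-- The pullback along `f : [m] ⟶ [n]`, in which `μ` is replaced by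
`φ(c_{a(f(m))}) ⟶ φ(c_{a(n)}) ⟶ d₀ ⟶ d_{f(0)}`. -/
def map {m n : SimplexCategory} (f : m ⟶ n) (x : CommaSimplex φ τ n) : CommaSimplex φ τ m where
  a := f ≫ x.a
  σ := (nerve D).map f.op x.σ
  μ := φ.map (τ.map (homOfLE (x.a.toOrderHom.monotone (Fin.le_last _)))) ≫ x.μ ≫
    x.σ.map (homOfLE (Fin.zero_le (f.toOrderHom 0)))

end CommaSimplex

/-- The pullback of `κ` along a simplex `τ` of the nerve of `C`. -/
def commaSimplices : SSet.{max u v} where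
  obj n := CommaSimplex φ τ n.unop
  map f := ↾CommaSimplex.map f.unop
  map_id n := by
    refine ConcreteCategory.hom_ext _ _ fun (x : CommaSimplex φ τ n.unop) => ?_
    refine Eq.trans ?_ ((x.restrict_congr (Category.id_comp x.a) le_rfl le_rfl).trans
      x.restrict_self)
    obtain ⟨a, σ, μ⟩ := x
    refine congrArg (CommaSimplex.mk _ _) ?_
    change _ ≫ μ ≫ σ.map (𝟙 0) = _ ≫ μ
    rw [CategoryTheory.Functor.map_id, Category.comp_id]
  map_comp {m n p} f g := by
    ext ⟨a, σ, μ⟩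
    refine congrArg (CommaSimplex.mk _ _) ?_
    let i : a.toOrderHom _ ⟶ a.toOrderHom _ :=
      homOfLE (a.toOrderHom.monotone (Fin.le_last (f.unop.toOrderHom (Fin.last n.unop.len))))
    let j : a.toOrderHom _ ⟶ a.toOrderHom _ :=
      homOfLE (a.toOrderHom.monotone (f.unop.toOrderHom.monotone
        (Fin.le_last (g.unop.toOrderHom (Fin.last p.unop.len)))))
    let k := homOfLE (Fin.zero_le (f.unop.toOrderHom 0))
    let l := homOfLE (f.unop.toOrderHom.monotone (Fin.zero_le (g.unop.toOrderHom 0)))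
    change φ.map (τ.map (j ≫ i)) ≫ μ ≫ σ.map (k ≫ l) =
      φ.map (τ.map j) ≫ (φ.map (τ.map i) ≫ μ ≫ σ.map k) ≫ σ.map l
    simp

/-- Functors to a category of costructured arrows are equal when their underlying functors and the
families of their structure morphisms are. -/
lemma functor_to_costructuredArrow_ext {J E E' : Type*} [Category* J] [Category* E] [Category* E']
    {F : E ⥤ E'} {X : E'} {K K' : J ⥤ CostructuredArrow F X}
    (h : K ⋙ CostructuredArrow.proj F X = K' ⋙ CostructuredArrow.proj F X)
    (h' : (fun j => (K.obj j).hom) ≍ (fun j => (K'.obj j).hom)) : K = K' := by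
  have aux (G G' : J ⥤ E) (hG : G = G') (f : ∀ j, F.obj (G.obj j) ⟶ X)
      (f' : ∀ j, F.obj (G'.obj j) ⟶ X) (hf : f ≍ f') (w w') :
      G.toCostructuredArrow F X f w = G'.toCostructuredArrow F X f' w' := by
    subst hG
    obtain rfl := eq_of_heq hf
    rfl
  exact aux (K ⋙ CostructuredArrow.proj F X) (K' ⋙ CostructuredArrow.proj F X) h
    (fun j => (K.obj j).hom) (fun j => (K'.obj j).hom) h'
    (fun g => CostructuredArrow.w (K.map g)) (fun g => CostructuredArrow.w (K'.map g))

/-- Functors to a category of structured arrows are equal when their underlying functors and the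
families of their structure morphisms are. -/
lemma functor_to_structuredArrow_ext {J E E' : Type*} [Category* J] [Category* E] [Category* E']
    {F : E ⥤ E'} {X : E'} {K K' : J ⥤ StructuredArrow X F}
    (h : K ⋙ StructuredArrow.proj X F = K' ⋙ StructuredArrow.proj X F)
    (h' : (fun j => (K.obj j).hom) ≍ (fun j => (K'.obj j).hom)) : K = K' := by
  have aux (G G' : J ⥤ E) (hG : G = G') (f : ∀ j, X ⟶ F.obj (G.obj j))
      (f' : ∀ j, X ⟶ F.obj (G'.obj j)) (hf : f ≍ f') (w w') :
      G.toStructuredArrow X F f w = G'.toStructuredArrow X F f' w' := by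
    subst hG
    obtain rfl := eq_of_heq hf
    rfl
  exact aux (K ⋙ StructuredArrow.proj X F) (K' ⋙ StructuredArrow.proj X F) h
    (fun j => (K.obj j).hom) (fun j => (K'.obj j).hom) h'
    (fun g => StructuredArrow.w (K.map g)) (fun g => StructuredArrow.w (K'.map g))

namespace CommaSimplex

/-- The projection to the homotopy colimit, `(a, σ, μ) ↦ (σ, (c_{a(i)} ⟶ d₀)_i)`. -/
def toHocolim : commaSimplices φ τ ⟶ hocolimSSet (nerveComma φ) where
  app n := ↾fun x => ⟨x.σ, Functor.toCostructuredArrow (x.a.toOrderHom.monotone.functor ⋙ τ) φ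
    (x.σ.obj 0) (fun i => φ.map (τ.map (homOfLE (x.a.toOrderHom.monotone (Fin.le_last i)))) ≫ x.μ)
    (fun g => by
      rw [← Category.assoc, ← Functor.map_comp]
      refine congrArg (fun k => φ.map k ≫ x.μ) ?_
      exact (τ.map_comp _ _).symm)⟩
  naturality {m n} f := by
    ext ⟨a, σ, μ⟩
    refine congrArg (Sigma.mk _) ?_
    let i (k : Fin (m.unop.len + 1)) : a.toOrderHom k ⟶ a.toOrderHom (Fin.last _) :=
      homOfLE (a.toOrderHom.monotone (Fin.le_last k))
    let j (k : Fin (n.unop.len + 1)) : a.toOrderHom (f.unop.toOrderHom k) ⟶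
        a.toOrderHom (f.unop.toOrderHom (Fin.last _)) :=
      homOfLE (a.toOrderHom.monotone (f.unop.toOrderHom.monotone (Fin.le_last k)))
    let l := homOfLE (Fin.zero_le (f.unop.toOrderHom 0))
    refine functor_to_costructuredArrow_ext rfl (heq_of_eq (funext fun k => ?_))
    change φ.map (τ.map (j k)) ≫ φ.map (τ.map (i _)) ≫ μ ≫ σ.map l =
      (φ.map (τ.map (i (f.unop.toOrderHom k))) ≫ μ) ≫ σ.map l
    have h : j k ≫ i (f.unop.toOrderHom (Fin.last _)) = i (f.unop.toOrderHom k) := rfl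
    rw [← h]
    simp only [Functor.map_comp, Category.assoc]

/-- The projection to the standard simplex. -/
def toStdSimplex : commaSimplices φ τ ⟶ SSet.stdSimplex.obj q where
  app n := ↾fun x => SSet.stdSimplex.objEquiv.symm x.a

/-- The retraction to the simplices with `a = 0`. -/
def toZero : commaSimplices φ τ ⟶ commaSimplices φ τ where
  app n := ↾fun x => x.restrict (constZero n.unop q) (Fin.zero_le _)
  naturality {m n} f := by
    ext ⟨a, σ, μ⟩
    refine congrArg (CommaSimplex.mk _ _) ?_
    let i : a.toOrderHom _ ⟶ a.toOrderHom _ :=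
      homOfLE (a.toOrderHom.monotone (Fin.le_last (f.unop.toOrderHom (Fin.last n.unop.len))))
    let j (k : Fin (m.unop.len + 1)) : 0 ⟶ a.toOrderHom k := homOfLE (Fin.zero_le _)
    let k := homOfLE (Fin.zero_le (f.unop.toOrderHom 0))
    change φ.map (τ.map (j _)) ≫ φ.map (τ.map i) ≫ μ ≫ σ.map k =
      φ.map (τ.map (𝟙 0)) ≫ (φ.map (τ.map (j _ ≫ i)) ≫ μ) ≫ σ.map k
    simp

/-- The vertices `a(i)` with `t(i) = 0` are moved to `0`, for `t : [n] ⟶ [1]`. As `0` is the smallest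
vertex, it is enough to restrict `μ`. -/
noncomputable def toZeroHomotopy : SimplicialObject.Homotopy (toZero φ τ) (𝟙 _) :=
  SSet.simplicialHomotopyOfNatural
    (fun _ x t => x.restrict (mixZero x.a t) (mixZero_le _ _ _))
    (fun {m n} f x t => by
      obtain ⟨a, σ, μ⟩ := x
      refine congrArg (CommaSimplex.mk _ _) ?_
      let l := f.toOrderHom (Fin.last m.len)
      let i : a.toOrderHom l ⟶ a.toOrderHom (Fin.last n.len) :=
        homOfLE (a.toOrderHom.monotone (Fin.le_last _))
      let i' : (mixZero a t).toOrderHom l ⟶ (mixZero a t).toOrderHom (Fin.last n.len) :=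
        homOfLE ((mixZero a t).toOrderHom.monotone (Fin.le_last _))
      let j (k : Fin (n.len + 1)) : (mixZero a t).toOrderHom k ⟶ a.toOrderHom k :=
        homOfLE (mixZero_le _ _ _)
      let k := homOfLE (Fin.zero_le (f.toOrderHom 0))
      have h : j l ≫ i = i' ≫ j (Fin.last n.len) := rfl
      change φ.map (τ.map (j l)) ≫ φ.map (τ.map i) ≫ μ ≫ σ.map k =
        φ.map (τ.map i') ≫ (φ.map (τ.map (j (Fin.last n.len))) ≫ μ) ≫ σ.map k
      simp only [← Category.assoc, ← Functor.map_comp, h])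
    (fun _ x t ht => x.restrict_congr (mixZero_eq_constZero _ t ht) _ _)
    (fun _ x t ht => (x.restrict_congr (mixZero_eq_self _ t ht) _ le_rfl).trans x.restrict_self)

/-- A simplex of the pullback gives a simplex `d₀ ⟶ ⋯ ⟶ dₙ` of the nerve of the category of objects
under `φ(c₀)`. -/
def toNerveUnder : commaSimplices φ τ ⟶ nerve (Under (φ.obj (τ.obj 0))) where
  app n := ↾fun x => (Functor.toStructuredArrow x.σ _ (𝟭 D)
    (fun i => φ.map (τ.map (homOfLE (Fin.zero_le _))) ≫ x.μ ≫ x.σ.map (homOfLE (Fin.zero_le i)))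
    (fun g => by
      simp only [Category.assoc]
      refine congrArg (fun k => _ ≫ _ ≫ k) ?_
      exact (x.σ.map_comp _ _).symm) : ComposableArrows _ n.unop.len)
  naturality {m n} f := by
    ext ⟨a, σ, μ⟩
    let z (k : Fin (q.len + 1)) : 0 ⟶ k := homOfLE (Fin.zero_le k)
    let i : a.toOrderHom _ ⟶ a.toOrderHom _ :=
      homOfLE (a.toOrderHom.monotone (Fin.le_last (f.unop.toOrderHom (Fin.last n.unop.len))))
    let l := homOfLE (Fin.zero_le (f.unop.toOrderHom 0))
    let l' (k : Fin (n.unop.len + 1)) : f.unop.toOrderHom 0 ⟶ f.unop.toOrderHom k :=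
      homOfLE (f.unop.toOrderHom.monotone (Fin.zero_le k))
    refine functor_to_structuredArrow_ext (F := 𝟭 D) rfl (heq_of_eq (funext fun k => ?_))
    change φ.map (τ.map (z _)) ≫ (φ.map (τ.map i) ≫ μ ≫ σ.map l) ≫ σ.map (l' k) =
      φ.map (τ.map (z _ ≫ i)) ≫ μ ≫ σ.map (l ≫ l' k)
    simp only [Functor.map_comp, Category.assoc]

/-- A simplex of the nerve of the category of objects under `φ(c₀)`, seen as a simplex with
`a = 0`. -/
def ofNerveUnder : nerve (Under (φ.obj (τ.obj 0))) ⟶ commaSimplices φ τ where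
  app n := ↾fun (x : ComposableArrows (Under (φ.obj (τ.obj 0))) n.unop.len) =>
    ⟨constZero n.unop q, x ⋙ Under.forget _, (x.obj 0).hom⟩
  naturality {m n} f := by
    refine ConcreteCategory.hom_ext _ _ fun
      (x : ComposableArrows (Under (φ.obj (τ.obj 0))) m.unop.len) => ?_
    refine congrArg (CommaSimplex.mk _ _) ?_
    let k := homOfLE (Fin.zero_le (f.unop.toOrderHom 0))
    change (x.obj (f.unop.toOrderHom 0)).hom =
      φ.map (τ.map (𝟙 0)) ≫ (x.obj 0).hom ≫ (x.map k).right
    simp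

lemma toNerveUnder_ofNerveUnder : toNerveUnder φ τ ≫ ofNerveUnder φ τ = toZero φ τ := by
  ext n ⟨a, σ, μ⟩
  refine congrArg (CommaSimplex.mk _ _) ?_
  change φ.map (τ.map _) ≫ μ ≫ σ.map (𝟙 0) = _
  rw [CategoryTheory.Functor.map_id, Category.comp_id]
  rfl

/-- The constant map to the simplices `φ(c₀) = ⋯ = φ(c₀)` over the vertex `c₀` of `τ`. -/
def fromStdSimplex : SSet.stdSimplex.obj q ⟶ commaSimplices φ τ where
  app n := ↾fun _ => ⟨constZero n.unop q, (Functor.const _).obj (φ.obj (τ.obj 0)), 𝟙 _⟩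
  naturality {m n} f := by
    ext x
    refine congrArg (CommaSimplex.mk _ _) ?_
    change 𝟙 _ = φ.map (τ.map (𝟙 0)) ≫ 𝟙 (φ.obj (τ.obj 0)) ≫ 𝟙 _
    simp

/-- The category of objects under `d` has the initial object `d`: this is the natural transformation
from the constant functor to the identity. -/
def underFromInitial (d : D) : (Functor.const (Under d)).obj (Under.mk (𝟙 d)) ⟶ 𝟭 (Under d) where
  app x := Under.homMk x.hom
  naturality x y f := by
    ext
    simp

/-- The simplices with `a = 0` form the nerve of the category of objects under `φ(c₀)`, which contracts
to its initial object. -/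
noncomputable def constHomotopy :
    SimplicialObject.Homotopy (toStdSimplex φ τ ≫ fromStdSimplex φ τ) (toZero φ τ) := by
  have h : (toNerveUnder φ τ ≫ nerveMap ((Functor.const _).obj (Under.mk (𝟙 _)))) ≫
      ofNerveUnder φ τ = toStdSimplex φ τ ≫ fromStdSimplex φ τ := rfl
  have h' : (toNerveUnder φ τ ≫ nerveMap (𝟭 _)) ≫ ofNerveUnder φ τ = toZero φ τ :=
    toNerveUnder_ofNerveUnder φ τ
  rw [← h, ← h']
  exact ((nerveHomotopy (underFromInitial (φ.obj (τ.obj 0)))).precomp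
    (toNerveUnder φ τ)).postcomp (ofNerveUnder φ τ)

end CommaSimplex

open CommaSimplex

/-- A lift of `c₀ ⟶ ⋯ ⟶ cₙ` to the category `φ/d` is the same thing as a morphism `φ(cₙ) ⟶ d`. -/
lemma existsUnique_structure_map {n : ℕ} {y : ComposableArrows C n} {d : D}
    (K : ComposableArrows (CostructuredArrow φ d) n) (h : y = K ⋙ CostructuredArrow.proj φ d) :
    ∃! μ : φ.obj (y.obj (Fin.last n)) ⟶ d,
      (fun j => φ.map (y.map (homOfLE (Fin.le_last j))) ≫ μ) ≍ (fun j => (K.obj j).hom) := by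
  subst h
  refine ⟨(K.obj (Fin.last n)).hom,
    heq_of_eq (funext fun j => CostructuredArrow.w (K.map _)), fun μ hμ => ?_⟩
  have h := congrFun (eq_of_heq hμ) (Fin.last n)
  change φ.map (K.map (𝟙 (Fin.last n))).left ≫ μ = (K.obj (Fin.last n)).hom at h
  rw [← h, K.map_id, Comma.id_left, φ.map_id]
  exact (Category.id_comp μ).symm

/-- The simplices of the homotopy colimit over a face `a^* τ` of `τ` are the `CommaSimplex`es with the
given `a`. -/
lemma commaSimplices_existsUnique (n : SimplexCategory)
    (s : (hocolimSSet (nerveComma φ)).obj (op n)) (a : n ⟶ q)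
    (h : (a.toOrderHom.monotone.functor ⋙ τ : ComposableArrows C n.len) =
      (kappa φ).app (op n) s) :
    ∃! x : CommaSimplex φ τ n, (toHocolim φ τ).app (op n) x = s ∧ x.a = a := by
  obtain ⟨σ, K⟩ := s
  obtain ⟨μ, hμ, hu⟩ := existsUnique_structure_map φ K h
  refine ⟨⟨a, σ, μ⟩, ⟨congrArg (Sigma.mk σ) (functor_to_costructuredArrow_ext h hμ), rfl⟩, ?_⟩
  rintro ⟨a', σ', μ'⟩ ⟨hx, rfl⟩
  obtain ⟨rfl, hK⟩ := Sigma.mk.inj hx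
  refine congrArg (CommaSimplex.mk (φ := φ) (τ := τ) a' σ') ?_
  exact hu μ' (congr_arg_heq
    (fun K : ComposableArrows (CostructuredArrow φ (σ'.obj 0)) n.len => fun j => (K.obj j).hom)
    (eq_of_heq hK))

/-- The pullbacks of `κ` along the simplices of the nerve of `C`. -/
def kappaPullbacks : CoeffSystem.SimplexPullbacks (kappa φ) where
  W t := commaSimplices φ (q := t.unop.1.unop) t.unop.2
  fst t := toHocolim φ _
  snd t := toStdSimplex φ _
  condition t n x := rfl
  existsUnique t n s a h := by
    obtain ⟨x, ⟨hx, hx'⟩, hu⟩ := commaSimplices_existsUnique φ (q := t.unop.1.unop) t.unop.2 n s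
      (SSet.stdSimplex.objEquiv a) h
    exact ⟨x, ⟨hx, congrArg SSet.stdSimplex.objEquiv.symm hx'⟩, fun y hy =>
      hu y ⟨hy.1, congrArg SSet.stdSimplex.objEquiv hy.2⟩⟩

end Comma

theorem theorem1p1 {R : Type r} [CommRing R] {C D : Type u} [Category.{v} C] [Category.{v} D]
    (φ : C ⥤ D) (M : CoeffSystem.{w} R (nerve C)) (n : ℕ) :
    IsIso (CoeffSystem.cohomologyMap (kappa φ) M n :
      thomasonCohomology C M n ⟶ (CoeffSystem.pullback (kappa φ) M).cohomology n) :=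
  CoeffSystem.isIso_cohomologyMap_of_coind (kappa φ)
    ((kappaPullbacks φ).isIso_cohomologyMap_coind (fun _ => CommaSimplex.fromStdSimplex φ _)
      (fun _ => CommaSimplex.toZero φ _) (fun _ => stdSimplexContraction _)
      (fun _ => CommaSimplex.constHomotopy φ _) (fun _ => CommaSimplex.toZeroHomotopy φ _))
    ((kappaPullbacks φ).isIso_cohomologyMap_coind (fun _ => CommaSimplex.fromStdSimplex φ _)
      (fun _ => CommaSimplex.toZero φ _) (fun _ => stdSimplexContraction _)
      (fun _ => CommaSimplex.constHomotopy φ _) (fun _ => CommaSimplex.toZeroHomotopy φ _)) n M
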